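/- Let $N\ge 1$ non-colluding databases each store the same $K$ independent messages $W_1,\dots,W_K$, where $W_i$ is uniform on $\mathbb{F}^{L_i}$ for a finite field $\mathbb{F}$, and the integers $L_1\ge\dots\ge L_K\ge 0$ satisfy $L_1>0$. The desired index $\theta$ has prior $P(\theta=i)=p_i>0$, $\sum_i p_i=1$, and $\mathbb{E}[L]=\sum_{i=1}^K p_iL_i$. A scheme consists, for each $i$, of a random tuple of discrete queries $(Q^{[i]}_1,\dots,Q^{[i]}_N)$, independent of the messages, and of answers $A^{[i]}_n$, which are strings over $\mathbb{F}$ and deterministic functions of $Q^{[i]}_n$ and $W_1,\dots,W_K$, the length of $A^{[i]}_n$ being a function of $Q^{[i]}_n$ alone. It is correct if for each $i$ the message $W_i$ is almost surely a function of $(A^{[i]}_1,\dots,A^{[i]}_N,Q^{[i]}_1,\dots,Q^{[i]}_N)$, and private if for each database $n$ the posterior probability that $\theta=i$, given the query that database $n$ receives, equals $p_i$ for every $i$. Its rate is $\mathbb{E}[L]/\mathbb{E}[D]$, where $\mathbb{E}[D]$ is the expected total number of symbols in the $N$ answers, averaged over $\theta$ and over the queries. Put $$C=\left(\sum_{i=1}^K\frac{L_i}{N^{i-1}\,\mathbb{E}[L]}\right)^{-1}.$$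 (a) If all $L_i$ are multiples of $N^K$, or all $L_i$ are multiples of $N-1$, then the semantic PIR capacity, that is, the supremum of the rates of all correct and private schemes for message lengths $L_1,\dots,L_K$, equals $C$. (b) For arbitrary $L_1\ge\dots\ge L_K$ as above, the supremum of the rates $T\,\mathbb{E}[L]/\mathbb{E}[D]$ of all correct and private schemes for message lengths $TL_1,\dots,TL_K$, taken over all integers $T\ge 1$, equals $C$. In particular, every correct and private scheme for lengths $L_1,\dots,L_K$ has rate at most $C$. -/

import Mathlib

open scoped ENNReal

namespace SemanticPIR

/-- The contents of `K` messages: message `i` is a string of `L i` symbols of the field `F`. -/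
abbrev Messages (F : Type) {K : ℕ} (L : Fin K → ℕ) : Type :=
  (i : Fin K) → Fin (L i) → F

/-- A retrieval scheme for `N` replicated databases storing messages of lengths `L` over `F`.
The user who wants message `i` draws a tuple of queries from `queryLaw i` and sends its `n`-th
entry to the `n`-th database. That database returns a string of symbols of `F` that is a
deterministic function of the query it received and of the stored messages; the number of symbols
it returns is determined by the query. -/
structure Scheme (F : Type) (N : ℕ) {K : ℕ} (L : Fin K → ℕ) where
  /-- the query alphabet -/
  Query : Type
  /-- the joint law of the `N` queries, for each desired message -/
  queryLaw : Fin K → PMF (Fin N → Query)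
  /-- the number of symbols the `n`-th database returns on a given query -/
  answerLength : Fin N → Query → ℕ
  /-- the answer string of the `n`-th database -/
  answer : (n : Fin N) → (x : Query) → Messages F L → Fin (answerLength n x) → F

/-- The law of the stored messages: independent, message `i` uniform on `F ^ (L i)`. -/
noncomputable def messageLaw (F : Type) [Field F] [Fintype F] {K : ℕ} (L : Fin K → ℕ) :
    PMF (Messages F L) :=
  PMF.uniformOfFintype (Messages F L)

namespace Scheme

variable {F : Type} {N K : ℕ} {L : Fin K → ℕ}

/-- The joint law of queries and messages when message `i` is desired; the queries are independent
of the messages. -/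
noncomputable def jointLaw [Field F] [Fintype F] (s : Scheme F N L) (i : Fin K) :
    PMF ((Fin N → s.Query) × Messages F L) :=
  (s.queryLaw i).bind fun q => (messageLaw F L).map fun w => (q, w)

/-- Correctness: when message `i` is desired, it is almost surely a function of all the queries
and all the answers, that is, `H(W_i | A_1, …, A_N, Q_1, …, Q_N) = 0`. -/
def IsCorrect [Field F] [Fintype F] (s : Scheme F N L) : Prop :=
  ∀ i : Fin K,
    ∃ decode : (q : Fin N → s.Query) →
        ((n : Fin N) → Fin (s.answerLength n (q n)) → F) → Fin (L i) → F,
      ∀ x ∈ (s.jointLaw i).support,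
        decode x.1 (fun n => s.answer n (x.1 n) x.2) = x.2 i

/-- The probability that the `n`-th database receives the query `x` when message `i` is desired. -/
noncomputable def queryProb (s : Scheme F N L) (i : Fin K) (n : Fin N) (x : s.Query) : ℝ :=
  ((s.queryLaw i).map (fun q => q n) x).toReal

/-- Privacy: for each single database, the posterior probability that the desired index is `i`,
given the query received (any query that occurs with positive probability), is the prior `p i`. -/
def IsPrivate (s : Scheme F N L) (p : Fin K → ℝ) : Prop :=
  ∀ (n : Fin N) (i : Fin K) (x : s.Query),
    0 < ∑ j, p j * s.queryProb j n x →
      p i * s.queryProb i n x / ∑ j, p j * s.queryProb j n x = p i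

/-- The expected total number of symbols downloaded, the desired index having law `p`. -/
noncomputable def expectedDownload (s : Scheme F N L) (p : Fin K → ℝ) : ℝ≥0∞ :=
  ∑ i, ENNReal.ofReal (p i) *
    ∑' q : Fin N → s.Query, s.queryLaw i q * ∑ n, (s.answerLength n (q n) : ℝ≥0∞)

end Scheme

/-- The expected message length `E[L]`. -/
noncomputable def expectedLength {K : ℕ} (L : Fin K → ℕ) (p : Fin K → ℝ) : ℝ :=
  ∑ i, p i * (L i : ℝ)

/-- The expected retrieval rate `E[L] / E[D]` (which is `0` if `E[D]` is infinite). -/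
noncomputable def Scheme.rate {F : Type} {N K : ℕ} {L : Fin K → ℕ} (s : Scheme F N L)
    (p : Fin K → ℝ) : ℝ :=
  expectedLength L p / (s.expectedDownload p).toReal

/-- The rates of all correct and private schemes for message lengths exactly `L`. -/
def achievableRates (F : Type) [Field F] [Fintype F] (N : ℕ) {K : ℕ} (L : Fin K → ℕ)
    (p : Fin K → ℝ) : Set ℝ :=
  {R | ∃ s : Scheme F N L, s.IsCorrect ∧ s.IsPrivate p ∧ R = s.rate p}

/-- The rates of all correct and private schemes for message lengths `T L_1, …, T L_K`, where
`T ≥ 1` is arbitrary: only the proportions of the message sizes are prescribed. -/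
def blockAchievableRates (F : Type) [Field F] [Fintype F] (N : ℕ) {K : ℕ} (L : Fin K → ℕ)
    (p : Fin K → ℝ) : Set ℝ :=
  {R | ∃ T : ℕ, 1 ≤ T ∧ R ∈ achievableRates F N (fun i => T * L i) p}

end SemanticPIR

/-! With `S = ∑ L_j / N^j` (indices from `0`), both bounds compare the expected download with `S`,
since the claimed capacity is `E[L] / S`.

Converse. Fix a query tuple `q` that can occur when message `k` is desired, and let `H_k(q)` be the
entropy of all answers given the messages before `k`. Correctness makes the answers determine
message `k`, so `H_k(q) = L_k log |F| + H_{k+1}(q)`. Now `H_{k+1}(q)` is at least `1/N` times the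
sum of the entropies of the single answers. Privacy makes each single query equally distributed for
all desired messages, so the expectation of that sum is the same when message `k+1` is desired;
there subadditivity bounds it below by the expectation of `H_{k+1}`. Unrolling this recursion gives
`S log |F| ≤ E[H_0] ≤ E[D] log |F|` (`le_expected_answerLength`). The messages being uniform,
entropy is a matter of counting: answers and known messages are equivalence relations on message
tuples, and `classEntropy s - classEntropy (r ⊓ s)` plays the role of `H(r | s)`.

Achievability. Message `i` is cut into equally many blocks for every `i`, and databases return sums
of at most one block per message, padded to the longest block present. A desired block is obtained
by subtracting the rest of its sum, which is itself requested. If `N - 1` divides all lengths, a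
uniform vector over `Fin N`, shifted by the database number in the desired coordinate, selects the
blocks. If `N ^ K` divides them, a symmetric scheme uses all sets of messages, with randomly
permuted blocks. As block lengths decrease with the index, the least message of a sum fixes its
length; grouping by it (`sum_powerset_pow_mul_sup`) makes the expected download exactly `S`. Hence
the suprema are attained, for arbitrary lengths with `T = N ^ K`. -/

namespace SemanticPIR

/-! ### Entropy of equivalence relations on a finite uniform space. -/

section Entropy

variable {Ω : Type*} [Fintype Ω]

open Classical in
/-- The number of points equivalent to `w`. -/
noncomputable def classCard (r : Setoid Ω) (w : Ω) : ℕ :=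
  (Finset.univ.filter fun w' => r w w').card

/-- The conditional entropy (in nats) of a uniform point of `Ω` given its equivalence class. -/
noncomputable def classEntropy (r : Setoid Ω) : ℝ :=
  (∑ w, Real.log (classCard r w)) / Fintype.card Ω

lemma classCard_pos (r : Setoid Ω) (w : Ω) : 0 < classCard r w := by
  classical
  exact Finset.card_pos.2 ⟨w, by simp⟩

lemma classCard_congr {r : Setoid Ω} {w w' : Ω} (h : r w w') :
    classCard r w = classCard r w' := by
  classical
  unfold classCard
  congr 1
  ext v
  simp only [Finset.mem_filter, Finset.mem_univ, true_and]
  exact ⟨fun hv => r.trans (r.symm h) hv, fun hv => r.trans h hv⟩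

lemma classCard_mono {r s : Setoid Ω} (h : r ≤ s) (w : Ω) : classCard r w ≤ classCard s w := by
  classical
  exact Finset.card_le_card fun v hv => by
    simp only [Finset.mem_filter, Finset.mem_univ, true_and] at hv ⊢
    exact h hv

lemma classEntropy_mono {r s : Setoid Ω} (h : r ≤ s) : classEntropy r ≤ classEntropy s := by
  unfold classEntropy
  gcongr with w
  · exact_mod_cast classCard_pos r w
  · exact_mod_cast classCard_mono h w

open Classical in
lemma sum_ite_inv_classCard (r : Setoid Ω) (w : Ω) :
    ∑ v, (if r w v then ((classCard r v : ℝ))⁻¹ else 0) = 1 := by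
  rw [← Finset.sum_filter]
  rw [Finset.sum_congr rfl (g := fun _ => (classCard r w : ℝ)⁻¹)]
  · rw [Finset.sum_const, nsmul_eq_mul]
    have := classCard_pos r w
    exact mul_inv_cancel₀ (by exact_mod_cast this.ne')
  · intro v hv
    rw [classCard_congr (Finset.mem_filter.1 hv).2]

/-- Each product of classes of `r ⊓ s` and `r' ⊓ s` inside one class of `s` meets a given
class of `r ⊓ r' ⊓ s` in at most one block. -/
lemma sum_classCard_ratio_le (r r' s : Setoid Ω) :
    ∑ w, ((classCard (r ⊓ s) w : ℝ) * classCard (r' ⊓ s) w) /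
      (classCard s w * classCard (r ⊓ r' ⊓ s) w) ≤ Fintype.card Ω := by
  classical
  have hr : ∀ (t : Setoid Ω) (w : Ω), (classCard t w : ℝ) = ∑ v, if t w v then (1 : ℝ) else 0 := by
    intro t w
    simp [classCard]
  -- The points `w` admissible for a given pair `(u, v)` form a single class of `r ⊓ r' ⊓ s` or
  -- none, and the inverse class sizes over one class sum to `1`.
  have key : ∀ u v : Ω, (∑ w, (if (r ⊓ s) w u ∧ (r' ⊓ s) w v then
      ((classCard s w : ℝ) * classCard (r ⊓ r' ⊓ s) w)⁻¹ else 0)) ≤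
        if s u v then (classCard s v : ℝ)⁻¹ else 0 := by
    intro u v
    by_cases hex : ∃ w₀, (r ⊓ s) w₀ u ∧ (r' ⊓ s) w₀ v
    · obtain ⟨w₀, h1, h2⟩ := hex
      have huv : s u v := s.trans (s.symm h1.2) h2.2
      rw [if_pos huv]
      calc _ ≤ ∑ w, (classCard s v : ℝ)⁻¹ *
            (if (r ⊓ r' ⊓ s) w₀ w then (classCard (r ⊓ r' ⊓ s) w : ℝ)⁻¹ else 0) := by
            refine Finset.sum_le_sum fun w _ => ?_
            by_cases hw : (r ⊓ s) w u ∧ (r' ⊓ s) w v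
            · have h3 : (r ⊓ r' ⊓ s) w₀ w :=
                ⟨⟨r.trans h1.1 (r.symm hw.1.1), r'.trans h2.1 (r'.symm hw.2.1)⟩,
                  s.trans h1.2 (s.symm hw.1.2)⟩
              rw [if_pos hw, if_pos h3, mul_inv, classCard_congr hw.2.2]
            · rw [if_neg hw]
              positivity
        _ = _ := by rw [← Finset.mul_sum, sum_ite_inv_classCard, mul_one]
    · push Not at hex
      rw [Finset.sum_eq_zero]
      · positivity
      · intro w _
        rw [if_neg]
        exact fun h => hex w h.1 h.2
  calc _ = ∑ w, ∑ u, ∑ v, (if (r ⊓ s) w u ∧ (r' ⊓ s) w v then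
      ((classCard s w : ℝ) * classCard (r ⊓ r' ⊓ s) w)⁻¹ else 0) := by
        refine Finset.sum_congr rfl fun w _ => ?_
        rw [hr (r ⊓ s), hr (r' ⊓ s), div_eq_mul_inv, Finset.sum_mul_sum, Finset.sum_mul]
        refine Finset.sum_congr rfl fun u _ => ?_
        rw [Finset.sum_mul]
        refine Finset.sum_congr rfl fun v _ => ?_
        by_cases h1 : (r ⊓ s) w u <;> by_cases h2 : (r' ⊓ s) w v <;> simp [h1, h2]
    _ = ∑ u, ∑ v, ∑ w, (if (r ⊓ s) w u ∧ (r' ⊓ s) w v then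
      ((classCard s w : ℝ) * classCard (r ⊓ r' ⊓ s) w)⁻¹ else 0) := by
        rw [Finset.sum_comm]
        refine Finset.sum_congr rfl fun u _ => ?_
        rw [Finset.sum_comm]
    _ ≤ ∑ u, ∑ v, if s u v then (classCard s v : ℝ)⁻¹ else 0 :=
        Finset.sum_le_sum fun u _ => Finset.sum_le_sum fun v _ => key u v
    _ = _ := by simp [sum_ite_inv_classCard]

/-- Nonnegativity of conditional mutual information: `log x ≤ x - 1` at the ratio of class sizes,
whose average is at most `1`. -/
lemma classEntropy_submodular (r r' s : Setoid Ω) :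
    classEntropy (r ⊓ s) + classEntropy (r' ⊓ s) ≤
      classEntropy s + classEntropy (r ⊓ r' ⊓ s) := by
  unfold classEntropy
  rw [← add_div, ← add_div]
  gcongr ?_ / _
  rw [← sub_nonneg, ← Finset.sum_add_distrib, ← Finset.sum_add_distrib, ← Finset.sum_sub_distrib]
  have h := sum_classCard_ratio_le r r' s
  have : 0 ≤ ∑ w, (1 - ((classCard (r ⊓ s) w : ℝ) * classCard (r' ⊓ s) w) /
      (classCard s w * classCard (r ⊓ r' ⊓ s) w)) := by
    simpa using h
  refine this.trans (Finset.sum_le_sum fun w _ => ?_)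
  have h1 : (0 : ℝ) < classCard (r ⊓ s) w := by exact_mod_cast classCard_pos _ w
  have h2 : (0 : ℝ) < classCard (r' ⊓ s) w := by exact_mod_cast classCard_pos _ w
  have h3 : (0 : ℝ) < classCard s w := by exact_mod_cast classCard_pos _ w
  have h4 : (0 : ℝ) < classCard (r ⊓ r' ⊓ s) w := by exact_mod_cast classCard_pos _ w
  have h5 := Real.log_le_sub_one_of_pos (div_pos (mul_pos h1 h2) (mul_pos h3 h4))
  rw [Real.log_div (mul_pos h1 h2).ne' (mul_pos h3 h4).ne', Real.log_mul h1.ne' h2.ne',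
    Real.log_mul h3.ne' h4.ne'] at h5
  linarith

/-- Subadditivity of the conditional entropy given `s`. -/
lemma classEntropy_sub_iInf_le {ι : Type*} [Fintype ι] (r : ι → Setoid Ω) (s : Setoid Ω) :
    classEntropy s - classEntropy ((⨅ n, r n) ⊓ s) ≤
      ∑ n, (classEntropy s - classEntropy (r n ⊓ s)) := by
  classical
  rw [← Finset.inf_univ_eq_iInf]
  induction (Finset.univ : Finset ι) using Finset.induction_on with
  | empty => simp
  | insert a t ha ih =>
    rw [Finset.sum_insert ha, Finset.inf_insert]
    have := classEntropy_submodular (r a) (t.inf r) s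
    linarith

lemma classCard_top (w : Ω) : classCard (⊤ : Setoid Ω) w = Fintype.card Ω := by
  classical
  simp [classCard, Setoid.top_def]

/-- The left side is the entropy of `f`. Inverse fibre sizes sum to the number of nonempty fibres,
so `log x ≤ x - 1` at `x = |Ω| / (|α| |fibre|)` gives the bound on average. -/
lemma classEntropy_top_sub_ker_le [Nonempty Ω] {α : Type*} [Fintype α] (f : Ω → α) :
    classEntropy (⊤ : Setoid Ω) - classEntropy (Setoid.ker f) ≤ Real.log (Fintype.card α) := by
  classical
  have : Nonempty α := ⟨f (Classical.arbitrary Ω)⟩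
  have hM : (0 : ℝ) < Fintype.card Ω := by exact_mod_cast Fintype.card_pos
  have hα : (0 : ℝ) < Fintype.card α := by exact_mod_cast Fintype.card_pos
  have hsum : ∑ w, (classCard (Setoid.ker f) w : ℝ)⁻¹ ≤ Fintype.card α := by
    calc _ = ∑ a : α, ∑ w, if f w = a then (classCard (Setoid.ker f) w : ℝ)⁻¹ else 0 := by
          rw [Finset.sum_comm]; simp
      _ ≤ ∑ a : α, 1 := by
          refine Finset.sum_le_sum fun a _ => ?_
          by_cases h : ∃ w, f w = a
          · obtain ⟨w, rfl⟩ := h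
            rw [← sum_ite_inv_classCard (Setoid.ker f) w]
            refine le_of_eq (Finset.sum_congr rfl fun v _ => ?_)
            simp [Setoid.ker_def, eq_comm]
          · push Not at h
            simp [h]
      _ = _ := by simp
  unfold classEntropy
  rw [← sub_div, div_le_iff₀ hM, ← Finset.sum_sub_distrib]
  have hb : ∀ w, Real.log (classCard (⊤ : Setoid Ω) w) - Real.log (classCard (Setoid.ker f) w) ≤
      Real.log (Fintype.card α) +
        (Fintype.card Ω / Fintype.card α * (classCard (Setoid.ker f) w : ℝ)⁻¹ - 1) := by
    intro w
    have h1 : (0 : ℝ) < classCard (Setoid.ker f) w := by exact_mod_cast classCard_pos _ w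
    have h5 := Real.log_le_sub_one_of_pos
      (show 0 < Fintype.card Ω / Fintype.card α * (classCard (Setoid.ker f) w : ℝ)⁻¹ by positivity)
    rw [Real.log_mul (by positivity) (by positivity), Real.log_div hM.ne' hα.ne',
      Real.log_inv] at h5
    rw [classCard_top]
    linarith
  refine (Finset.sum_le_sum fun w _ => hb w).trans ?_
  rw [Finset.sum_add_distrib, Finset.sum_sub_distrib, ← Finset.mul_sum]
  simp only [Finset.sum_const, Finset.card_univ, nsmul_eq_mul, mul_one]
  have : (Fintype.card Ω / Fintype.card α : ℝ) * ∑ w, (classCard (Setoid.ker f) w : ℝ)⁻¹ ≤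
      Fintype.card Ω := by
    calc _ ≤ (Fintype.card Ω / Fintype.card α : ℝ) * Fintype.card α := by gcongr
      _ = _ := by field_simp
  linarith

end Entropy

lemma tsum_map_mul {α β : Type*} (P : PMF α) (g : α → β) (f : β → ℝ≥0∞) :
    ∑' b, P.map g b * f b = ∑' a, P a * f (g a) := by
  classical
  simp only [PMF.map_apply, ← ENNReal.tsum_mul_right]
  rw [ENNReal.tsum_comm]
  refine tsum_congr fun a => ?_
  rw [tsum_eq_single (g a)]
  · simp
  · intro b hb
    simp [hb]

/-- Two message tuples are equivalent if their first `k` messages agree. -/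
def agreeBelow (F : Type) {K : ℕ} (L : Fin K → ℕ) (k : ℕ) : Setoid (Messages F L) where
  r w w' := ∀ j : Fin K, (j : ℕ) < k → w j = w' j
  iseqv := ⟨fun _ _ _ => rfl, fun h j hj => (h j hj).symm,
    fun h h' j hj => (h j hj).trans (h' j hj)⟩

lemma agreeBelow_zero (F : Type) {K : ℕ} (L : Fin K → ℕ) : agreeBelow F L 0 = ⊤ := by
  rw [eq_top_iff]
  intro w w' _ j hj
  omega

lemma agreeBelow_succ (F : Type) {K : ℕ} (L : Fin K → ℕ) (k : Fin K) :
    agreeBelow F L (k + 1) = (Setoid.ker fun w : Messages F L => w k) ⊓ agreeBelow F L k := by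
  ext w w'
  constructor
  · intro h
    exact ⟨h k (by omega), fun j hj => h j (by omega)⟩
  · rintro ⟨h1, h2⟩ j hj
    rcases Nat.lt_succ_iff_lt_or_eq.1 hj with h | h
    · exact h2 j h
    · obtain rfl := Fin.ext h
      exact h1

/-! ### Converse: a lower bound on the expected download. -/

section Converse

variable {F : Type} {N K : ℕ} {L : Fin K → ℕ}

lemma classCard_agreeBelow [Fintype F] (k : ℕ) (w : Messages F L) :
    classCard (agreeBelow F L k) w =
      ∏ j : Fin K, if (j : ℕ) < k then 1 else Fintype.card F ^ L j := by
  classical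
  have : (Finset.univ.filter fun w' => agreeBelow F L k w w') =
      Fintype.piFinset fun j : Fin K => if (j : ℕ) < k then {w j} else Finset.univ := by
    ext w'
    simp only [Finset.mem_filter, Finset.mem_univ, true_and, Fintype.mem_piFinset]
    refine forall_congr' fun j => ?_
    by_cases hj : (j : ℕ) < k <;> simp [hj, eq_comm]
  rw [classCard, this, Fintype.card_piFinset]
  refine Finset.prod_congr rfl fun j _ => ?_
  by_cases hj : (j : ℕ) < k <;> simp [hj]

lemma classEntropy_agreeBelow_succ [Nonempty F] [Fintype F] (k : Fin K) :
    classEntropy (agreeBelow F L k) =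
      L k * Real.log (Fintype.card F) + classEntropy (agreeBelow F L (k + 1)) := by
  classical
  have hF : (0 : ℝ) < Fintype.card F := by exact_mod_cast Fintype.card_pos
  have hM : (0 : ℝ) < Fintype.card (Messages F L) := by exact_mod_cast Fintype.card_pos
  have hcard : ∀ w : Messages F L, classCard (agreeBelow F L k) w =
      Fintype.card F ^ L k * classCard (agreeBelow F L (k + 1)) w := by
    intro w
    rw [classCard_agreeBelow, classCard_agreeBelow, ← Finset.mul_prod_erase _ _ (Finset.mem_univ k),
      ← Finset.mul_prod_erase Finset.univ (fun j : Fin K => if (j : ℕ) < k + 1 then 1 else _)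
        (Finset.mem_univ k)]
    simp only [lt_irrefl, if_false, Nat.lt_succ_self, if_true, one_mul]
    congr 1
    refine Finset.prod_congr rfl fun j hj => ?_
    have : (j : ℕ) ≠ k := fun h => Finset.ne_of_mem_erase hj (Fin.ext h)
    have : (j : ℕ) < k ↔ (j : ℕ) < k + 1 := by omega
    simp [this]
  unfold classEntropy
  rw [← sub_eq_iff_eq_add, ← sub_div, ← Finset.sum_sub_distrib,
    Finset.sum_congr rfl (g := fun _ => (L k : ℝ) * Real.log (Fintype.card F))]
  · simp only [Finset.sum_const, Finset.card_univ, nsmul_eq_mul]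
    field_simp
  · intro w _
    have := classCard_pos (agreeBelow F L (k + 1)) w
    rw [hcard w]
    push_cast
    rw [Real.log_mul (by positivity) (by positivity), Real.log_pow]
    ring

namespace Scheme

/-- Message tuples are equivalent if all databases give the same answers to the queries `q`. -/
def sameAnswers (s : Scheme F N L) (q : Fin N → s.Query) : Setoid (Messages F L) :=
  ⨅ n, Setoid.ker (s.answer n (q n))

/-- Bayes' rule: cancelling the positive prior turns equality of posterior and prior into equality
of marginals. A query of total probability zero has probability zero for every desired message,
again because the priors are positive. -/
lemma queryLaw_map_eq {s : Scheme F N L} {p : Fin K → ℝ} (hp : ∀ i, 0 < p i)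
    (hs : s.IsPrivate p) (n : Fin N) (i j : Fin K) :
    (s.queryLaw i).map (fun q => q n) = (s.queryLaw j).map (fun q => q n) := by
  ext x
  have hnn : ∀ k, 0 ≤ s.queryProb k n x := fun k => ENNReal.toReal_nonneg
  have key : s.queryProb i n x = s.queryProb j n x := by
    rcases (Finset.sum_nonneg fun k _ => mul_nonneg (hp k).le (hnn k) :
      0 ≤ ∑ k, p k * s.queryProb k n x).eq_or_lt with h | h
    · have h0 := (Finset.sum_eq_zero_iff_of_nonneg
        fun k _ => mul_nonneg (hp k).le (hnn k)).1 h.symm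
      have h1 : ∀ k, s.queryProb k n x = 0 := fun k =>
        (mul_eq_zero.1 (h0 k (Finset.mem_univ k))).resolve_left (hp k).ne'
      rw [h1, h1]
    · have h1 : ∀ k, s.queryProb k n x = ∑ k, p k * s.queryProb k n x := by
        intro k
        have := hs n k x h
        rw [div_eq_iff h.ne'] at this
        exact mul_left_cancel₀ (hp k).ne' this
      rw [h1 i, h1 j]
  exact (ENNReal.toReal_eq_toReal_iff' (PMF.apply_ne_top _ _) (PMF.apply_ne_top _ _)).1 key

/-- The expectation of a sum of functions of the individual queries does not depend on the
desired message. -/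
lemma tsum_queryLaw_mul_sum_eq {s : Scheme F N L} {p : Fin K → ℝ} (hp : ∀ i, 0 < p i)
    (hs : s.IsPrivate p) (u : Fin N → s.Query → ℝ≥0∞) (i j : Fin K) :
    ∑' q, s.queryLaw i q * ∑ n, u n (q n) = ∑' q, s.queryLaw j q * ∑ n, u n (q n) := by
  have : ∀ k, ∑' q, s.queryLaw k q * ∑ n, u n (q n) =
      ∑ n, ∑' x, (s.queryLaw k).map (fun q => q n) x * u n x := by
    intro k
    simp only [tsum_map_mul, Finset.mul_sum]
    exact Summable.tsum_finsetSum fun _ _ => ENNReal.summable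
  rw [this, this]
  exact Finset.sum_congr rfl fun n _ => by rw [queryLaw_map_eq hp hs n i j]

/-- Every message tuple has positive probability, so almost sure decoding is decoding for all tuples
once `q` is possible. -/
lemma sameAnswers_le_ker [Field F] [Fintype F] {s : Scheme F N L} (hs : s.IsCorrect) {i : Fin K}
    {q : Fin N → s.Query} (hq : q ∈ (s.queryLaw i).support) :
    s.sameAnswers q ≤ Setoid.ker fun w : Messages F L => w i := by
  intro w w' h
  obtain ⟨d, hd⟩ := hs i
  have hmem : ∀ v : Messages F L, (q, v) ∈ (s.jointLaw i).support := by
    intro v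
    rw [jointLaw, PMF.mem_support_bind_iff]
    refine ⟨q, hq, ?_⟩
    rw [PMF.mem_support_map_iff]
    exact ⟨v, by simp [messageLaw], rfl⟩
  have h1 : ∀ n, s.answer n (q n) w = s.answer n (q n) w' := by
    intro n
    have := (iInf_le (fun n => Setoid.ker (s.answer n (q n))) n) h
    exact this
  change w i = w' i
  have e := hd _ (hmem w)
  have e' := hd _ (hmem w')
  simp only [h1] at e
  exact e.symm.trans e'

/-- The conditional entropy of the answers given the first `k` messages. -/
noncomputable def answerEntropy [Fintype F] (s : Scheme F N L) (k : ℕ) (q : Fin N → s.Query) : ℝ :=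
  classEntropy (agreeBelow F L k) - classEntropy (s.sameAnswers q ⊓ agreeBelow F L k)

lemma answerEntropy_nonneg [Fintype F] (s : Scheme F N L) (k : ℕ) (q : Fin N → s.Query) :
    0 ≤ s.answerEntropy k q :=
  sub_nonneg.2 (classEntropy_mono inf_le_right)

/-- Given the answers, knowing message `i` as well adds nothing; without them it accounts for `L i`
symbols. -/
lemma answerEntropy_eq_add [Field F] [Fintype F] {s : Scheme F N L} (hs : s.IsCorrect) {i : Fin K}
    {q : Fin N → s.Query} (hq : q ∈ (s.queryLaw i).support) :
    s.answerEntropy i q = L i * Real.log (Fintype.card F) + s.answerEntropy (i + 1) q := by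
  have h : s.sameAnswers q ⊓ agreeBelow F L i = s.sameAnswers q ⊓ agreeBelow F L (i + 1) := by
    rw [agreeBelow_succ, ← inf_assoc, inf_eq_left.2 (sameAnswers_le_ker hs hq)]
  rw [answerEntropy, answerEntropy, h, classEntropy_agreeBelow_succ]
  ring

lemma answerEntropy_le_sum [Fintype F] (s : Scheme F N L) (k : ℕ) (q : Fin N → s.Query) :
    s.answerEntropy k q ≤ ∑ n, (classEntropy (agreeBelow F L k) -
      classEntropy (Setoid.ker (s.answer n (q n)) ⊓ agreeBelow F L k)) :=
  classEntropy_sub_iInf_le _ _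

lemma sum_le_mul_answerEntropy [Fintype F] (s : Scheme F N L) (k : ℕ) (q : Fin N → s.Query) :
    ∑ n, (classEntropy (agreeBelow F L k) -
      classEntropy (Setoid.ker (s.answer n (q n)) ⊓ agreeBelow F L k)) ≤
        N * s.answerEntropy k q := by
  calc _ ≤ ∑ _n : Fin N, s.answerEntropy k q := by
        refine Finset.sum_le_sum fun n _ => sub_le_sub_left (classEntropy_mono ?_) _
        exact inf_le_inf_right _ (iInf_le _ n)
    _ = _ := by simp

lemma answerEntropy_zero_le [Nonempty F] [Fintype F] (s : Scheme F N L) (q : Fin N → s.Query) :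
    s.answerEntropy 0 q ≤ (∑ n, s.answerLength n (q n) : ℕ) * Real.log (Fintype.card F) := by
  have h : s.sameAnswers q =
      Setoid.ker fun (w : Messages F L) n => s.answer n (q n) w := by
    refine le_antisymm (fun w w' hw => funext fun n => ?_) (le_iInf fun n w w' hw => ?_)
    · exact (iInf_le (fun n => Setoid.ker (s.answer n (q n))) n) hw
    · exact congrFun hw n
  have := classEntropy_top_sub_ker_le fun (w : Messages F L) n => s.answer n (q n) w
  rw [answerEntropy, agreeBelow_zero, inf_top_eq, h]
  refine this.trans (le_of_eq ?_)
  rw [Fintype.card_pi]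
  simp only [Fintype.card_pi, Finset.prod_const, Finset.card_univ, Fintype.card_fin]
  rw [Finset.prod_pow_eq_pow_sum]
  push_cast
  rw [Real.log_pow]
  push_cast
  rfl

end Scheme

/-- The recursion of the converse unrolled; the induction carries the remainder `c ^ k * R k`. -/
lemma sum_mul_inv_pow_le {K : ℕ} (c : ℝ≥0∞) (a R : ℕ → ℝ≥0∞)
    (h : ∀ k < K, a k + c * R (k + 1) ≤ R k) : ∑ k ∈ Finset.range K, a k * c ^ k ≤ R 0 := by
  have : ∀ k ≤ K, ∑ j ∈ Finset.range k, a j * c ^ j + c ^ k * R k ≤ R 0 := by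
    intro k
    induction k with
    | zero => simp
    | succ k ih =>
      intro hk
      refine le_trans ?_ (ih (by omega))
      rw [Finset.sum_range_succ, add_assoc]
      gcongr
      calc _ = c ^ k * (a k + c * R (k + 1)) := by ring
        _ ≤ _ := by gcongr; exact h k (by omega)
  exact le_trans le_self_add (this K le_rfl)

namespace Scheme

lemma le_expected_answerLength [Field F] [Fintype F] {s : Scheme F N L} {p : Fin K → ℝ} (hN : 1 ≤ N)
    (hp : ∀ i, 0 < p i) (hc : s.IsCorrect) (hs : s.IsPrivate p) (i : Fin K) :
    ENNReal.ofReal (∑ j : Fin K, (L j : ℝ) / (N : ℝ) ^ (j : ℕ)) ≤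
      ∑' q, s.queryLaw i q * ∑ n, (s.answerLength n (q n) : ℝ≥0∞) := by
  set lam := Real.log (Fintype.card F) with hlam
  have hlam0 : 0 < lam := Real.log_pos (by exact_mod_cast Fintype.one_lt_card)
  have hN0 : (0 : ℝ) < N := by exact_mod_cast hN
  have hK : 0 < K := i.pos
  -- The desired message changes with `k`: message `k` is desired while the messages before it are
  -- known. The value `0` from `K` on ends the recursion.
  let R : ℕ → ℝ≥0∞ := fun k => if h : k < K then
    ∑' q, s.queryLaw ⟨k, h⟩ q * ENNReal.ofReal (s.answerEntropy k q) else 0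
  let a : ℕ → ℝ≥0∞ := fun k => if h : k < K then ENNReal.ofReal (L ⟨k, h⟩ * lam) else 0
  have hstep : ∀ k < K, a k + (N : ℝ≥0∞)⁻¹ * R (k + 1) ≤ R k := by
    intro k hk
    have hRk : R k = a k +
        ∑' q, s.queryLaw ⟨k, hk⟩ q * ENNReal.ofReal (s.answerEntropy (k + 1) q) := by
      simp only [R, a, dif_pos hk]
      calc _ = ∑' q, (s.queryLaw ⟨k, hk⟩ q * ENNReal.ofReal (L ⟨k, hk⟩ * lam) +
            s.queryLaw ⟨k, hk⟩ q * ENNReal.ofReal (s.answerEntropy (k + 1) q)) := by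
            refine tsum_congr fun q => ?_
            by_cases hq : q ∈ (s.queryLaw ⟨k, hk⟩).support
            · rw [← mul_add, ← ENNReal.ofReal_add (by positivity) (s.answerEntropy_nonneg _ _)]
              rw [← answerEntropy_eq_add hc hq]
            · rw [PMF.mem_support_iff, not_not] at hq
              simp [hq]
        _ = _ := by
            rw [ENNReal.tsum_add, ENNReal.tsum_mul_right, PMF.tsum_coe, one_mul]
    rw [hRk]
    gcongr
    by_cases hk1 : k + 1 < K
    · simp only [R, dif_pos hk1]
      rw [ENNReal.inv_mul_le_iff (by exact_mod_cast (by omega : N ≠ 0)) (by simp)]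
      let u : Fin N → s.Query → ℝ≥0∞ := fun n x => ENNReal.ofReal
        (classEntropy (agreeBelow F L (k + 1)) -
          classEntropy (Setoid.ker (s.answer n x) ⊓ agreeBelow F L (k + 1)))
      have hu : ∀ q : Fin N → s.Query, ∑ n, u n (q n) = ENNReal.ofReal
          (∑ n, (classEntropy (agreeBelow F L (k + 1)) -
            classEntropy (Setoid.ker (s.answer n (q n)) ⊓ agreeBelow F L (k + 1)))) := by
        intro q
        rw [ENNReal.ofReal_sum_of_nonneg]
        exact fun n _ => sub_nonneg.2 (classEntropy_mono inf_le_right)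
      -- Subadditivity when message `k + 1` is desired, privacy to pass to message `k`, then each
      -- answer entropy is at most the joint one.
      calc _ ≤ ∑' q, s.queryLaw ⟨k + 1, hk1⟩ q * ∑ n, u n (q n) := by
            refine ENNReal.tsum_le_tsum fun q => ?_
            rw [hu]
            gcongr
            exact s.answerEntropy_le_sum _ q
        _ = ∑' q, s.queryLaw ⟨k, hk⟩ q * ∑ n, u n (q n) :=
            tsum_queryLaw_mul_sum_eq hp hs u _ _
        _ ≤ ∑' q, N * (s.queryLaw ⟨k, hk⟩ q * ENNReal.ofReal (s.answerEntropy (k + 1) q)) := by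
            refine ENNReal.tsum_le_tsum fun q => ?_
            rw [hu, mul_left_comm]
            gcongr
            rw [← ENNReal.ofReal_natCast, ← ENNReal.ofReal_mul hN0.le]
            exact ENNReal.ofReal_le_ofReal (s.sum_le_mul_answerEntropy _ q)
        _ = _ := ENNReal.tsum_mul_left
    · simp [R, dif_neg hk1]
  have hchain := sum_mul_inv_pow_le _ a R hstep
  have hR0 : R 0 ≤ ENNReal.ofReal lam *
      ∑' q, s.queryLaw ⟨0, hK⟩ q * ∑ n, (s.answerLength n (q n) : ℝ≥0∞) := by
    simp only [R, dif_pos hK]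
    rw [← ENNReal.tsum_mul_left]
    refine ENNReal.tsum_le_tsum fun q => ?_
    rw [mul_left_comm]
    gcongr
    refine (ENNReal.ofReal_le_ofReal (s.answerEntropy_zero_le q)).trans ?_
    rw [mul_comm, ENNReal.ofReal_mul hlam0.le, ENNReal.ofReal_natCast]
    push_cast
    rfl
  have hsum : ∑ k ∈ Finset.range K, a k * (N : ℝ≥0∞)⁻¹ ^ k =
      ENNReal.ofReal lam * ENNReal.ofReal (∑ j : Fin K, (L j : ℝ) / (N : ℝ) ^ (j : ℕ)) := by
    rw [Finset.sum_range, ENNReal.ofReal_sum_of_nonneg (fun j _ => by positivity), Finset.mul_sum]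
    refine Finset.sum_congr rfl fun j _ => ?_
    simp only [a, dif_pos j.2, Fin.eta]
    rw [← ENNReal.ofReal_mul hlam0.le, ← ENNReal.ofReal_natCast, ← ENNReal.ofReal_inv_of_pos hN0,
      ← ENNReal.ofReal_pow (by positivity), ← ENNReal.ofReal_mul (by positivity)]
    congr 1
    rw [inv_pow]
    ring
  rw [hsum] at hchain
  have := hchain.trans hR0
  rw [ENNReal.mul_le_mul_iff_right (by simpa using hlam0) (by simp)] at this
  refine this.trans (le_of_eq ?_)
  -- The bound was obtained with message `0` desired; privacy carries it over to message `i`.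
  exact tsum_queryLaw_mul_sum_eq hp hs (fun n x => (s.answerLength n x : ℝ≥0∞)) _ _

lemma le_expectedDownload [Field F] [Fintype F] {s : Scheme F N L} {p : Fin K → ℝ} (hN : 1 ≤ N)
    (hp : ∀ i, 0 < p i) (hpsum : ∑ i, p i = 1) (hc : s.IsCorrect) (hs : s.IsPrivate p) :
    ENNReal.ofReal (∑ j : Fin K, (L j : ℝ) / (N : ℝ) ^ (j : ℕ)) ≤ s.expectedDownload p := by
  calc _ = ∑ i, ENNReal.ofReal (p i) *
        ENNReal.ofReal (∑ j : Fin K, (L j : ℝ) / (N : ℝ) ^ (j : ℕ)) := by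
        rw [← Finset.sum_mul, ← ENNReal.ofReal_sum_of_nonneg fun i _ => (hp i).le, hpsum]
        simp
    _ ≤ _ := by
        unfold expectedDownload
        gcongr with i
        exact le_expected_answerLength hN hp hc hs i

end Scheme

lemma expectedLength_pos {p : Fin K → ℝ} (hp : ∀ i, 0 < p i) (hLpos : ∃ i, 0 < L i) :
    0 < expectedLength L p := by
  obtain ⟨i, hi⟩ := hLpos
  refine Finset.sum_pos' (fun j _ => mul_nonneg (hp j).le (by positivity)) ⟨i, Finset.mem_univ i, ?_⟩
  exact mul_pos (hp i) (by exact_mod_cast hi)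

lemma sum_div_pow_pos (hN : 1 ≤ N) (hLpos : ∃ i, 0 < L i) :
    0 < ∑ j : Fin K, (L j : ℝ) / (N : ℝ) ^ (j : ℕ) := by
  obtain ⟨i, hi⟩ := hLpos
  have hN0 : (0 : ℝ) < N := by exact_mod_cast hN
  refine Finset.sum_pos' (fun j _ => by positivity) ⟨i, Finset.mem_univ i, ?_⟩
  have : (0 : ℝ) < L i := by exact_mod_cast hi
  positivity

lemma capacity_eq {p : Fin K → ℝ} :
    (∑ i : Fin K, (L i : ℝ) / ((N : ℝ) ^ (i : ℕ) * expectedLength L p))⁻¹ =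
      expectedLength L p / ∑ j : Fin K, (L j : ℝ) / (N : ℝ) ^ (j : ℕ) := by
  simp_rw [← div_div, ← Finset.sum_div, inv_div]

lemma rate_le_capacity [Field F] [Fintype F] {p : Fin K → ℝ} (hN : 1 ≤ N) (hLpos : ∃ i, 0 < L i)
    (hp : ∀ i, 0 < p i) (hpsum : ∑ i, p i = 1) {R : ℝ} (hR : R ∈ achievableRates F N L p) :
    R ≤ expectedLength L p / ∑ j : Fin K, (L j : ℝ) / (N : ℝ) ^ (j : ℕ) := by
  obtain ⟨s, hc, hs, rfl⟩ := hR
  have hE := expectedLength_pos hp hLpos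
  have hS := sum_div_pow_pos hN hLpos
  by_cases htop : s.expectedDownload p = ⊤
  · rw [Scheme.rate, htop]
    simp only [ENNReal.toReal_top, div_zero]
    positivity
  · unfold Scheme.rate
    gcongr
    exact (ENNReal.ofReal_le_iff_le_toReal htop).1 (Scheme.le_expectedDownload hN hp hpsum hc hs)

end Converse

/-! ### Schemes returning sums of message blocks. -/

section BlockScheme

variable {F : Type} {N K : ℕ} {L m : Fin K → ℕ} {B X Ω : Type}

/-- The `t`-th symbol of block `b` of message `i`, padded by zeros beyond the block length. -/
def symbolAt [Zero F] (e : (i : Fin K) → Fin (L i) ≃ B × Fin (m i)) (w : Messages F L)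
    (i : Fin K) (b : B) (t : ℕ) : F :=
  if h : t < m i then w i ((e i).symm (b, ⟨t, h⟩)) else 0

lemma eq_of_symbolAt_eq [Zero F] (e : (i : Fin K) → Fin (L i) ≃ B × Fin (m i))
    {w w' : Messages F L} {i : Fin K} (h : ∀ b t, symbolAt e w i b t = symbolAt e w' i b t) :
    w i = w' i := by
  funext l
  have := h (e i l).1 (e i l).2
  simpa [symbolAt] using this

/-- The length of a sum of blocks, at most one block being taken from each message. -/
def blockLength (m : Fin K → ℕ) (c : Fin K → Option B) : ℕ :=
  (Finset.univ.filter fun i => (c i).isSome).sup m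

/-- The `t`-th symbol of a sum of blocks, at most one block being taken from each message. -/
def blockSum [AddCommMonoid F] (e : (i : Fin K) → Fin (L i) ≃ B × Fin (m i)) (w : Messages F L)
    (c : Fin K → Option B) (t : ℕ) : F :=
  ∑ i, (c i).elim 0 fun b => symbolAt e w i b t

/-- Symbols that are not transmitted are known to vanish, so an answer determines its padded sums at
every position. -/
lemma blockSum_eq_zero [AddCommMonoid F] (e : (i : Fin K) → Fin (L i) ≃ B × Fin (m i))
    (w : Messages F L) (c : Fin K → Option B) {t : ℕ} (ht : blockLength m c ≤ t) :
    blockSum e w c t = 0 := by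
  refine Finset.sum_eq_zero fun i _ => ?_
  cases hi : c i with
  | none => rfl
  | some b =>
    have : m i ≤ blockLength m c := Finset.le_sup (f := m) (by simp [hi])
    simp [symbolAt, (this.trans ht).not_gt]

lemma blockSum_sub_update [AddCommGroup F] (e : (i : Fin K) → Fin (L i) ≃ B × Fin (m i))
    (w : Messages F L) {c : Fin K → Option B} {i : Fin K} {b : B} (hc : c i = some b) (t : ℕ) :
    blockSum e w c t - blockSum e w (Function.update c i none) t = symbolAt e w i b t := by
  rw [blockSum, blockSum, ← Finset.sum_sub_distrib, Finset.sum_eq_single i]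
  · simp [hc]
  · intro j _ hj
    simp [hj]
  · simp

/-- The scheme in which each database returns, for each `x : X`, a sum of blocks, the requested
blocks being determined by a uniform seed in `Ω`. -/
noncomputable def blockScheme [AddCommMonoid F] [Fintype X] [Fintype Ω] [Nonempty Ω]
    (e : (i : Fin K) → Fin (L i) ≃ B × Fin (m i))
    (Q : Fin K → Ω → Fin N → X → Fin K → Option B) : Scheme F N L where
  Query := X → Fin K → Option B
  queryLaw i := (PMF.uniformOfFintype Ω).map (Q i)
  answerLength _ q := Fintype.card (Σ x, Fin (blockLength m (q x)))
  answer _ q w a := blockSum e w (q ((Fintype.equivFin _).symm a).1) ((Fintype.equivFin _).symm a).2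

variable [Fintype X] [Fintype Ω] [Nonempty Ω]

/-- If every block of the desired message occurs in a requested sum whose remaining part is itself
requested, possibly from another database, then the scheme is correct. -/
lemma blockScheme_isCorrect [Field F] [Fintype F]
    (e : (i : Fin K) → Fin (L i) ≃ B × Fin (m i))
    (Q : Fin K → Ω → Fin N → X → Fin K → Option B)
    (hQ : ∀ i ω b, ∃ n x n' x', Q i ω n x i = some b ∧
      Q i ω n' x' = Function.update (Q i ω n x) i none) :
    (blockScheme (F := F) e Q).IsCorrect := by
  classical
  intro i
  let s : Scheme F N L := blockScheme e Q
  have hinj : ∀ ω (w w' : Messages F L),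
      (∀ n, s.answer n (Q i ω n) w = s.answer n (Q i ω n) w') → w i = w' i := by
    intro ω w w' h
    have hsum : ∀ n x t, blockSum e w (Q i ω n x) t = blockSum e w' (Q i ω n x) t := by
      intro n x t
      by_cases ht : t < blockLength m (Q i ω n x)
      · have := congrFun (h n) (Fintype.equivFin
          (Σ x, Fin (blockLength m (Q i ω n x))) ⟨x, ⟨t, ht⟩⟩)
        change (fun y : Σ x, Fin (blockLength m (Q i ω n x)) => blockSum e w (Q i ω n y.1) y.2)
          ((Fintype.equivFin _).symm (Fintype.equivFin _ _)) =
          (fun y : Σ x, Fin (blockLength m (Q i ω n x)) => blockSum e w' (Q i ω n y.1) y.2)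
          ((Fintype.equivFin _).symm (Fintype.equivFin _ _)) at this
        rwa [Equiv.symm_apply_apply] at this
      · rw [blockSum_eq_zero _ _ _ (not_lt.1 ht), blockSum_eq_zero _ _ _ (not_lt.1 ht)]
    refine eq_of_symbolAt_eq e fun b t => ?_
    obtain ⟨n, x, n', x', h1, h2⟩ := hQ i ω b
    rw [← blockSum_sub_update e w h1, ← blockSum_sub_update e w' h1, ← h2, hsum, hsum]
  -- The decoder picks any message tuple consistent with the answers; by `hinj` its entry `i` is the
  -- right one.
  refine ⟨fun q a => if h : ∃ w : Messages F L, ∀ n, s.answer n (q n) w = a n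
    then h.choose i else 0, ?_⟩
  rintro ⟨q, w⟩ hx
  change (q, w) ∈ (s.jointLaw i).support at hx
  change (if h : ∃ w' : Messages F L, ∀ n, s.answer n (q n) w' = s.answer n (q n) w
    then h.choose i else 0) = w i
  have hq : q ∈ (s.queryLaw i).support := by
    rw [Scheme.jointLaw, PMF.mem_support_bind_iff] at hx
    obtain ⟨q', hq', hx⟩ := hx
    rw [PMF.mem_support_map_iff] at hx
    obtain ⟨_, _, h⟩ := hx
    exact (Prod.mk.inj h).1 ▸ hq'
  obtain ⟨ω, _, rfl⟩ := (PMF.mem_support_map_iff (Q i) (PMF.uniformOfFintype Ω) q).1 hq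
  have hex : ∃ w' : Messages F L, ∀ n, s.answer n (Q i ω n) w' = s.answer n (Q i ω n) w :=
    ⟨w, fun _ => rfl⟩
  rw [dif_pos hex]
  exact hinj ω _ _ hex.choose_spec

lemma uniformOfFintype_map_equiv (σ : Equiv.Perm Ω) :
    (PMF.uniformOfFintype Ω).map σ = PMF.uniformOfFintype Ω := by
  ext ω
  classical
  rw [PMF.map_apply, tsum_eq_single (σ.symm ω)]
  · simp
  · intro b hb
    rw [if_neg]
    rintro rfl
    simp at hb

/-- If, up to a permutation of the seeds, the query to each database does not depend on the desired
message, then the scheme is private. -/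
lemma blockScheme_isPrivate [AddCommMonoid F]
    (e : (i : Fin K) → Fin (L i) ≃ B × Fin (m i))
    (Q : Fin K → Ω → Fin N → X → Fin K → Option B)
    (hQ : ∀ n i j, ∃ σ : Equiv.Perm Ω, ∀ ω, Q i (σ ω) n = Q j ω n)
    {p : Fin K → ℝ} (hpsum : ∑ i, p i = 1) :
    (blockScheme (F := F) e Q).IsPrivate p := by
  intro n i x hx
  have h : ∀ j, (blockScheme (F := F) e Q).queryProb j n x =
      (blockScheme (F := F) e Q).queryProb i n x := by
    intro j
    obtain ⟨σ, hσ⟩ := hQ n i j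
    change ((((PMF.uniformOfFintype Ω).map (Q j)).map fun q => q n) x).toReal =
      ((((PMF.uniformOfFintype Ω).map (Q i)).map fun q => q n) x).toReal
    have hcomp : (fun q : Fin N → X → Fin K → Option B => q n) ∘ Q j =
        ((fun q : Fin N → X → Fin K → Option B => q n) ∘ Q i) ∘ σ :=
      funext fun ω => (hσ ω).symm
    rw [PMF.map_comp, hcomp, ← PMF.map_comp, uniformOfFintype_map_equiv, ← PMF.map_comp]
  simp only [h, ← Finset.sum_mul, hpsum, one_mul] at hx ⊢
  rw [mul_div_assoc, div_self hx.ne', mul_one]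

lemma blockScheme_rate [AddCommMonoid F]
    (e : (i : Fin K) → Fin (L i) ≃ B × Fin (m i))
    (Q : Fin K → Ω → Fin N → X → Fin K → Option B)
    {p : Fin K → ℝ} (hp : ∀ i, 0 < p i) (hpsum : ∑ i, p i = 1) {d : ℝ} (hd : 0 ≤ d)
    (hQ : ∀ i, ((∑ ω, ∑ n, ∑ x, blockLength m (Q i ω n x) : ℕ) : ℝ) = Fintype.card Ω * d) :
    (blockScheme (F := F) e Q).rate p = expectedLength L p / d := by
  have hΩ : (0 : ℝ) < Fintype.card Ω := by exact_mod_cast Fintype.card_pos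
  have hi : ∀ i, ∑' q, (blockScheme (F := F) e Q).queryLaw i q *
      ∑ n, ((blockScheme (F := F) e Q).answerLength n (q n) : ℝ≥0∞) = ENNReal.ofReal d := by
    intro i
    refine (tsum_map_mul _ _ _).trans ?_
    simp only [blockScheme, Fintype.card_sigma, Fintype.card_fin, tsum_fintype,
      PMF.uniformOfFintype_apply]
    have hsum : ∑ ω, ∑ n, ((∑ x, blockLength m (Q i ω n x) : ℕ) : ℝ≥0∞) =
        Fintype.card Ω * ENNReal.ofReal d := by
      rw [← ENNReal.ofReal_natCast, ← ENNReal.ofReal_mul hΩ.le, ← hQ, ENNReal.ofReal_natCast]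
      push_cast
      rfl
    rw [← Finset.mul_sum, hsum, ENNReal.inv_mul_cancel_left (by simp) (by simp)]
  have : (blockScheme (F := F) e Q).expectedDownload p = ENNReal.ofReal d := by
    unfold Scheme.expectedDownload
    simp only [hi]
    rw [← Finset.sum_mul, ← ENNReal.ofReal_sum_of_nonneg fun i _ => (hp i).le, hpsum]
    simp
  rw [Scheme.rate, this, ENNReal.toReal_ofReal hd]

end BlockScheme

/-! ### Counting sums of blocks by their sets of messages. -/

section Counting

/-- Summing over the nonempty sets by their least element. -/
lemma sum_powerset_pow_mul_sup {α : Type*} [LinearOrder α] {m : α → ℕ} (hm : Antitone m) (M : ℕ)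
    (U : Finset α) :
    ∑ S ∈ U.powerset, M ^ (S.card - 1) * S.sup m =
      ∑ k ∈ U, m k * (M + 1) ^ (U.filter (k < ·)).card := by
  induction U using Finset.induction_on_min with
  | empty => simp
  | insert a U ha ih =>
    have haU : a ∉ U := fun h => lt_irrefl _ (ha a h)
    rw [Finset.sum_powerset_insert haU, Finset.sum_insert haU, ih, add_comm]
    congr 1
    · have h1 : (insert a U).filter (a < ·) = U := by
        ext x
        simp only [Finset.mem_filter, Finset.mem_insert]
        constructor
        · rintro ⟨rfl | h, h2⟩
          · exact absurd h2 (lt_irrefl _)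
          · exact h
        · exact fun h => ⟨Or.inr h, ha x h⟩
      rw [h1]
      -- Sets with least element `a` all have supremum `m a`; the binomial theorem adds up their
      -- weights `M ^ |S|`.
      have := Finset.sum_pow_mul_eq_add_pow M 1 U
      rw [← this, Finset.mul_sum]
      refine Finset.sum_congr rfl fun S hS => ?_
      rw [Finset.mem_powerset] at hS
      have haS : a ∉ S := fun h => haU (hS h)
      rw [Finset.card_insert_of_notMem haS, Finset.sup_insert, Nat.add_sub_cancel, one_pow, mul_one,
        mul_comm, sup_eq_left.2]
      exact Finset.sup_le fun j hj => hm (ha j (hS hj)).le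
    · refine Finset.sum_congr rfl fun k hk => ?_
      rw [Finset.filter_insert, if_neg (ha k hk).not_gt]

lemma sum_pow_mul_sup {K : ℕ} {m : Fin K → ℕ} (hm : Antitone m) (M : ℕ) :
    ∑ S : Finset (Fin K), M ^ (S.card - 1) * S.sup m =
      ∑ k : Fin K, m k * (M + 1) ^ (K - 1 - k) := by
  rw [← Finset.powerset_univ, sum_powerset_pow_mul_sup hm]
  refine Finset.sum_congr rfl fun k _ => ?_
  have : Finset.univ.filter (k < ·) = Finset.Ioi k := by ext; simp
  rw [this, Fin.card_Ioi]

/-- In the symmetric scheme this counts the sums of one database that involve message `i`. -/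
lemma sum_pow_card_of_mem {K : ℕ} (i : Fin K) (M : ℕ) :
    ∑ S : Finset (Fin K), (if i ∈ S then M ^ (S.card - 1) else 0) = (M + 1) ^ (K - 1) := by
  have hi : i ∉ Finset.univ.erase i := by simp
  rw [← Finset.powerset_univ, ← Finset.insert_erase (Finset.mem_univ i),
    Finset.sum_powerset_insert hi, Finset.sum_eq_zero, zero_add]
  · have := Finset.sum_pow_mul_eq_add_pow M 1 (Finset.univ.erase i)
    rw [Finset.card_erase_of_mem (Finset.mem_univ i), Finset.card_univ, Fintype.card_fin] at this
    rw [← this]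
    refine Finset.sum_congr rfl fun S hS => ?_
    have : i ∉ S := fun h => hi (Finset.mem_powerset.1 hS h)
    simp [Finset.card_insert_of_notMem this]
  · intro S hS
    rw [if_neg fun h => hi (Finset.mem_powerset.1 hS h)]

lemma card_filter_support {K : ℕ} (M : ℕ) (S : Finset (Fin K)) :
    (Finset.univ.filter fun c : Fin K → Option (Fin M) =>
      (Finset.univ.filter fun i => (c i).isSome) = S).card = M ^ S.card := by
  classical
  have : (Finset.univ.filter fun c : Fin K → Option (Fin M) =>
      (Finset.univ.filter fun i => (c i).isSome) = S) =
      Fintype.piFinset fun i => if i ∈ S then Finset.univ.erase none else {none} := by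
    ext c
    simp only [Finset.mem_filter, Finset.mem_univ, true_and, Fintype.mem_piFinset, Finset.ext_iff]
    refine forall_congr' fun i => ?_
    by_cases hi : i ∈ S <;> simp [hi, Option.isSome_iff_ne_none]
  rw [this, Fintype.card_piFinset]
  have : ∀ i, (if i ∈ S then Finset.univ.erase (none : Option (Fin M)) else {none}).card =
      if i ∈ S then M else 1 := by
    intro i
    by_cases hi : i ∈ S <;> simp [hi]
  simp [this]

lemma sum_blockLength {K : ℕ} {m : Fin K → ℕ} (hm : Antitone m) (M : ℕ) :
    ∑ c : Fin K → Option (Fin M), blockLength m c =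
      M * ∑ k : Fin K, m k * (M + 1) ^ (K - 1 - k) := by
  rw [← sum_pow_mul_sup hm, Finset.mul_sum, ← Finset.sum_fiberwise
    (g := fun c : Fin K → Option (Fin M) => Finset.univ.filter fun i => (c i).isSome)]
  refine Finset.sum_congr rfl fun S _ => ?_
  rw [Finset.sum_congr rfl (g := fun _ => S.sup m), Finset.sum_const, card_filter_support,
    smul_eq_mul]
  -- For the empty set the truncated exponent is wrong by one, but the length is `0`.
  · rcases S.eq_empty_or_nonempty with rfl | hS
    · simp
    · rw [← mul_assoc, ← pow_succ', Nat.sub_add_cancel hS.card_pos]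
  · intro c hc
    rw [blockLength, (Finset.mem_filter.1 hc).2]

end Counting

/-! ### The scheme for lengths divisible by `N - 1`. -/

section RandomizedScheme

variable {K M : ℕ}

/-- The requests in the randomized scheme: a uniform vector, shifted by `n` in the coordinate of
the desired message, selects one of the `M` blocks or no block of each message. -/
def shiftedRequest (M : ℕ) (i : Fin K) (ω : Fin K → Fin (M + 1)) (n : Fin (M + 1)) (_ : Unit)
    (j : Fin K) : Option (Fin M) :=
  finSuccEquiv M ((ω + Pi.single i n : Fin K → Fin (M + 1)) j)

/-- Across the databases, coordinate `i` takes every value while the others stay fixed: one database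
adds block `b` to the common rest, another returns the rest alone. -/
lemma exists_shiftedRequest (i : Fin K) (ω : Fin K → Fin (M + 1)) (b : Fin M) :
    ∃ n x n' x', shiftedRequest M i ω n x i = some b ∧
      shiftedRequest M i ω n' x' = Function.update (shiftedRequest M i ω n x) i none := by
  refine ⟨(finSuccEquiv M).symm (some b) - ω i, (), (finSuccEquiv M).symm none - ω i, (), ?_, ?_⟩
  · simp only [shiftedRequest, Pi.add_apply, Pi.single_eq_same, add_sub_cancel,
      Equiv.apply_symm_apply]
  · funext j
    by_cases hj : j = i
    · subst hj
      simp only [shiftedRequest, Pi.add_apply, Pi.single_eq_same, add_sub_cancel,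
        Equiv.apply_symm_apply, Function.update_self]
    · simp only [shiftedRequest, Pi.add_apply, Pi.single_eq_of_ne hj, Function.update_of_ne hj]

/-- Translating the seed compensates for moving the shift to another coordinate. -/
lemma exists_perm_shiftedRequest (n : Fin (M + 1)) (i j : Fin K) :
    ∃ σ : Equiv.Perm (Fin K → Fin (M + 1)), ∀ ω,
      shiftedRequest M i (σ ω) n = shiftedRequest M j ω n := by
  refine ⟨Equiv.addRight (Pi.single j n - Pi.single i n), fun ω => ?_⟩
  funext x k
  simp only [shiftedRequest, Equiv.coe_addRight]
  rw [add_assoc, sub_add_cancel]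

lemma sum_blockLength_shiftedRequest {m : Fin K → ℕ} (hm : Antitone m) (i : Fin K) :
    ∑ ω, ∑ n, ∑ x, blockLength m (shiftedRequest M i ω n x) =
      (M + 1) * (M * ∑ k : Fin K, m k * (M + 1) ^ (K - 1 - k)) := by
  rw [Finset.sum_comm, ← sum_blockLength hm]
  have : ∀ n : Fin (M + 1), ∑ ω, ∑ x, blockLength m (shiftedRequest M i ω n x) =
      ∑ c : Fin K → Option (Fin M), blockLength m c := by
    intro n
    simp only [Finset.univ_unique, Finset.sum_singleton]
    exact Equiv.sum_comp ((Equiv.addRight (Pi.single i n : Fin K → Fin (M + 1))).trans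
      (Equiv.piCongrRight fun _ => finSuccEquiv M)) (blockLength m)
  simp only [this, Finset.sum_const, Finset.card_univ, Fintype.card_fin, smul_eq_mul]

end RandomizedScheme

/-! ### The symmetric scheme for lengths divisible by `N ^ K`. -/

section DeterministicScheme

variable {K M : ℕ}

/-- The sums a database returns in the symmetric scheme: `M ^ (|S| - 1)` sums of one block from each
message in `S`, for every set `S` of messages. -/
abbrev Slot (K M : ℕ) : Type :=
  Σ S : Finset (Fin K), Fin (M ^ (S.card - 1))

lemma Slot.ext {x y : Slot K M} (h₁ : x.1 = y.1) (h₂ : (x.2 : ℕ) = y.2) : x = y := by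
  obtain ⟨S, t⟩ := x
  obtain ⟨S', t'⟩ := y
  obtain rfl : S = S' := h₁
  obtain rfl : t = t' := Fin.ext h₂
  rfl

/-- Makes `x.2 / M` a legitimate slot number once `i` is removed. For a singleton the number is `0`,
and the empty set has one slot because the exponent truncates. -/
lemma Slot.div_lt {i : Fin K} {x : Slot K M} (h : i ∈ x.1) :
    (x.2 : ℕ) / M < M ^ ((x.1.erase i).card - 1) := by
  have hx := x.2.2
  have hpos : 0 < x.1.card := Finset.card_pos.2 ⟨i, h⟩
  rw [Finset.card_erase_of_mem h]
  rcases Nat.lt_or_ge 1 x.1.card with h1 | h1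
  · refine Nat.div_lt_of_lt_mul ?_
    rw [← pow_succ']
    convert hx using 2
    omega
  · obtain hc : x.1.card = 1 := by omega
    simp only [hc, Nat.sub_self, pow_zero, Nat.lt_one_iff] at hx
    simp [hx, hc]

/-- The database and the sum from which the undesired part of the sum `x` of database `n` is known,
when message `i` is desired. -/
def sideInfo (i : Fin K) (n : Fin (M + 1)) (x : Slot K M) : Fin (M + 1) × Slot K M :=
  if h : i ∈ x.1 then
    -- Division with remainder by `M`: the remainder chooses one of the `M` other databases, the
    -- quotient a sum there.
    (n + Fin.ofNat (M + 1) (1 + x.2 % M), ⟨x.1.erase i, ⟨x.2 / M, Slot.div_lt h⟩⟩)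
  else (n, x)

lemma sideInfo_of_notMem {i : Fin K} {n : Fin (M + 1)} {x : Slot K M} (h : i ∉ x.1) :
    sideInfo i n x = (n, x) :=
  dif_neg h

lemma sideInfo_snd_fst (i : Fin K) (n : Fin (M + 1)) (x : Slot K M) :
    (sideInfo i n x).2.1 = x.1.erase i := by
  by_cases h : i ∈ x.1
  · simp [sideInfo, h]
  · simp [sideInfo, h]

lemma sideInfo_fst_ne {i j : Fin K} (hij : j ≠ i) {n : Fin (M + 1)} {x : Slot K M}
    (hi : i ∈ x.1) (hj : j ∈ x.1) :
    0 < M ∧ (sideInfo i n x).1 ≠ n := by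
  have hM : 0 < M := by
    rcases Nat.eq_zero_or_pos M with h | h
    · have hc : 1 < x.1.card := Finset.one_lt_card.2 ⟨i, hi, j, hj, hij.symm⟩
      have h0 : M ^ (x.1.card - 1) = 0 := by simp only [h]; exact zero_pow (by omega)
      exact absurd x.2.2 (by omega)
    · exact h
  refine ⟨hM, fun h => ?_⟩
  simp only [sideInfo, dif_pos hi, add_eq_left] at h
  have h2 := congrArg Fin.val h
  have := Nat.mod_lt (x.2 : ℕ) hM
  simp only [Fin.val_ofNat, Fin.val_zero] at h2
  rw [Nat.mod_eq_of_lt (by omega)] at h2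
  omega

/-- Quotient and remainder recover the slot number, and sums with and without message `i` cannot
collide, since only the former point to another database. -/
lemma sideInfo_injOn {i j : Fin K} (hij : j ≠ i) (n : Fin (M + 1)) :
    Set.InjOn (sideInfo (M := M) i n) {x | j ∈ x.1} := by
  intro x (hx : j ∈ x.1) y (hy : j ∈ y.1) hxy
  by_cases h1 : i ∈ x.1 <;> by_cases h2 : i ∈ y.1
  · have hM := (sideInfo_fst_ne (n := n) hij h1 hx).1
    simp only [sideInfo, dif_pos h1, dif_pos h2, Prod.mk.injEq, add_right_inj] at hxy
    obtain ⟨ha, hb⟩ := hxy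
    have hS : x.1 = y.1 := by
      rw [← Finset.insert_erase h1, ← Finset.insert_erase h2, (Sigma.mk.inj_iff.1 hb).1]
    have hdiv : (x.2 : ℕ) / M = y.2 / M :=
      congrArg (fun z : Slot K M => (z.2 : ℕ)) hb
    have hmod : (x.2 : ℕ) % M = y.2 % M := by
      have h3 := congrArg Fin.val ha
      have := Nat.mod_lt (x.2 : ℕ) hM
      have := Nat.mod_lt (y.2 : ℕ) hM
      have hx' : (1 + (x.2 : ℕ) % M) % (M + 1) = 1 + x.2 % M := Nat.mod_eq_of_lt (by omega)
      have hy' : (1 + (y.2 : ℕ) % M) % (M + 1) = 1 + y.2 % M := Nat.mod_eq_of_lt (by omega)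
      rw [Fin.val_ofNat, Fin.val_ofNat, hx', hy'] at h3
      omega
    refine Slot.ext hS ?_
    rw [← Nat.div_add_mod (x.2 : ℕ) M, hdiv, hmod, Nat.div_add_mod]
  · refine absurd ?_ (sideInfo_fst_ne (n := n) hij h1 hx).2
    rw [hxy, sideInfo_of_notMem h2]
  · refine absurd ?_ (sideInfo_fst_ne (n := n) hij h2 hy).2
    rw [← hxy, sideInfo_of_notMem h1]
  · rw [sideInfo_of_notMem h1, sideInfo_of_notMem h2] at hxy
    exact (Prod.mk.inj hxy).2

/-- Each of the `M + 1` databases returns `(M + 1) ^ (K - 1)` sums involving message `i`; this is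
the origin of the `N ^ K` blocks. -/
lemma exists_bijOn_blocks (M : ℕ) (i : Fin K) :
    ∃ c : Fin (M + 1) × Slot K M → Fin ((M + 1) ^ K),
      Set.BijOn c {y | i ∈ y.2.1} Set.univ := by
  classical
  have hcard : Fintype.card {y : Fin (M + 1) × Slot K M // i ∈ y.2.1} =
      Fintype.card (Fin ((M + 1) ^ K)) := by
    rw [Fintype.card_subtype, Finset.card_filter, Fintype.sum_prod_type]
    have hS : ∀ S : Finset (Fin K), ∑ _t : Fin (M ^ (S.card - 1)), (if i ∈ S then 1 else 0) =
        if i ∈ S then M ^ (S.card - 1) else 0 := by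
      intro S
      split_ifs <;> simp
    simp only [Fintype.sum_sigma, hS, Finset.sum_const, Finset.card_univ, Fintype.card_fin,
      smul_eq_mul]
    rw [sum_pow_card_of_mem, ← pow_succ', Nat.sub_add_cancel i.pos]
  let f := Fintype.equivOfCardEq hcard
  have : NeZero ((M + 1) ^ K) := ⟨by positivity⟩
  have hf : ∀ (y : Fin (M + 1) × Slot K M) (h : i ∈ y.2.1),
      (if h : i ∈ y.2.1 then f ⟨y, h⟩ else 0) = f ⟨y, h⟩ := fun y h => dif_pos h
  refine ⟨fun y => if h : i ∈ y.2.1 then f ⟨y, h⟩ else 0, fun _ _ => Set.mem_univ _, ?_, ?_⟩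
  · intro y hy z hz hyz
    simp only [hf y hy, hf z hz] at hyz
    exact congrArg Subtype.val (f.injective hyz)
  · intro b _
    refine ⟨(f.symm b).1, (f.symm b).2, ?_⟩
    simp only [hf _ (f.symm b).2]
    simp

/-- A numbering of the blocks of message `i`: one block for each sum involving message `i` that is
returned by some database. -/
noncomputable def blockNumber (M : ℕ) (i : Fin K) : Fin (M + 1) × Slot K M → Fin ((M + 1) ^ K) :=
  (exists_bijOn_blocks M i).choose

lemma blockNumber_bijOn (M : ℕ) (i : Fin K) :
    Set.BijOn (blockNumber M i) {y | i ∈ y.2.1} Set.univ :=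
  (exists_bijOn_blocks M i).choose_spec

/-- The number of the block of message `j` in the sum `x` of database `n`, before permutation, when
message `i` is desired. -/
noncomputable def requestNumber (M : ℕ) (i : Fin K) (n : Fin (M + 1)) (x : Slot K M) (j : Fin K) :
    Fin ((M + 1) ^ K) :=
  -- The desired message contributes a fresh block to each sum; the others repeat their blocks from
  -- the side information.
  blockNumber M j (if j = i then (n, x) else sideInfo i n x)

/-- The source of privacy: no database sees a block twice, and random permutations hide everything
else. -/
lemma requestNumber_injOn (i : Fin K) (n : Fin (M + 1)) (j : Fin K) :
    Set.InjOn (fun x => requestNumber M i n x j) {x | j ∈ x.1} := by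
  intro x (hx : j ∈ x.1) y (hy : j ∈ y.1) hxy
  by_cases hj : j = i
  · simp only [requestNumber, if_pos hj] at hxy
    exact (Prod.mk.inj ((blockNumber_bijOn M j).injOn hx hy hxy)).2
  · simp only [requestNumber, if_neg hj] at hxy
    refine sideInfo_injOn hj n hx hy ((blockNumber_bijOn M j).injOn ?_ ?_ hxy)
    · simp [sideInfo_snd_fst, hj, hx]
    · simp [sideInfo_snd_fst, hj, hy]

/-- The requests in the symmetric scheme, the blocks of each message being permuted uniformly. -/
noncomputable def permutedRequest (M : ℕ) (i : Fin K)
    (π : Fin K → Equiv.Perm (Fin ((M + 1) ^ K))) (n : Fin (M + 1)) (x : Slot K M) (j : Fin K) :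
    Option (Fin ((M + 1) ^ K)) :=
  if j ∈ x.1 then some (π j (requestNumber M i n x j)) else none

lemma exists_permutedRequest (i : Fin K) (π : Fin K → Equiv.Perm (Fin ((M + 1) ^ K)))
    (b : Fin ((M + 1) ^ K)) :
    ∃ n x n' x', permutedRequest M i π n x i = some b ∧
      permutedRequest M i π n' x' = Function.update (permutedRequest M i π n x) i none := by
  obtain ⟨⟨n, x⟩, hx, hb⟩ := (blockNumber_bijOn M i).surjOn (Set.mem_univ ((π i).symm b))
  replace hx : i ∈ x.1 := hx
  refine ⟨n, x, (sideInfo i n x).1, (sideInfo i n x).2, ?_, ?_⟩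
  · simp [permutedRequest, requestNumber, hx, hb]
  · have hi : i ∉ (sideInfo i n x).2.1 := by simp [sideInfo_snd_fst]
    funext j
    by_cases hj : j = i
    · subst hj
      simp [permutedRequest, hi]
    · rw [Function.update_of_ne hj]
      simp only [permutedRequest, requestNumber, if_neg hj, sideInfo_of_notMem hi]
      simp [sideInfo_snd_fst, hj]

/-- The bijection between the two ranges extends to a permutation because `β` is finite. -/
lemma exists_perm_apply_eq {α β : Type*} [Finite β] {f g : α → β} (hf : f.Injective)
    (hg : g.Injective) : ∃ ρ : Equiv.Perm β, ∀ a, ρ (f a) = g a := by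
  classical
  have := Fintype.ofFinite β
  let e : {b // b ∈ Set.range f} ≃ {b // b ∈ Set.range g} :=
    (Equiv.ofInjective f hf).symm.trans (Equiv.ofInjective g hg)
  refine ⟨e.extendSubtype, fun a => ?_⟩
  rw [Equiv.extendSubtype_apply_of_mem e _ ⟨a, rfl⟩]
  have : (⟨f a, ⟨a, rfl⟩⟩ : {b // b ∈ Set.range f}) = Equiv.ofInjective f hf a := rfl
  change (Equiv.ofInjective g hg ((Equiv.ofInjective f hf).symm ⟨f a, ⟨a, rfl⟩⟩) : β) = g a
  rw [this, Equiv.symm_apply_apply, Equiv.ofInjective_apply]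

/-- For each message the two injective numberings at database `n` differ by a permutation of the
blocks, which right multiplication absorbs into the seed. -/
lemma exists_perm_permutedRequest (n : Fin (M + 1)) (i i' : Fin K) :
    ∃ σ : Equiv.Perm (Fin K → Equiv.Perm (Fin ((M + 1) ^ K))), ∀ π,
      permutedRequest M i (σ π) n = permutedRequest M i' π n := by
  have h : ∀ j : Fin K, ∃ ρ : Equiv.Perm (Fin ((M + 1) ^ K)), ∀ x : {x : Slot K M // j ∈ x.1},
      ρ (requestNumber M i n x j) = requestNumber M i' n x j := fun j =>
    exists_perm_apply_eq (f := fun x : {x : Slot K M // j ∈ x.1} => requestNumber M i n x j)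
      (Set.injOn_iff_injective.1 (requestNumber_injOn i n j))
      (Set.injOn_iff_injective.1 (requestNumber_injOn i' n j))
  choose ρ hρ using h
  refine ⟨Equiv.piCongrRight fun j => Equiv.mulRight (ρ j), fun π => ?_⟩
  funext x j
  by_cases hj : j ∈ x.1
  · simp [permutedRequest, hj, hρ j ⟨x, hj⟩]
  · simp [permutedRequest, hj]

lemma sum_blockLength_permutedRequest {m : Fin K → ℕ} (hm : Antitone m) (i : Fin K) :
    ∑ π, ∑ n, ∑ x, blockLength m (permutedRequest M i π n x) =
      Fintype.card (Fin K → Equiv.Perm (Fin ((M + 1) ^ K))) *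
        ((M + 1) * ∑ k : Fin K, m k * (M + 1) ^ (K - 1 - k)) := by
  have : ∀ π n, ∑ x, blockLength m (permutedRequest M i π n x) =
      ∑ k : Fin K, m k * (M + 1) ^ (K - 1 - k) := by
    intro π n
    rw [← sum_pow_mul_sup hm, Fintype.sum_sigma]
    have hS : ∀ x : Slot K M, blockLength m (permutedRequest M i π n x) = x.1.sup m := by
      intro x
      rw [blockLength]
      congr 1
      ext j
      by_cases hj : j ∈ x.1 <;> simp [permutedRequest, hj]
    simp [hS]
  simp only [this, Finset.sum_const, Finset.card_univ, Fintype.card_fin, smul_eq_mul]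

end DeterministicScheme

/-! ### Attaining the capacity. -/

section Capacity

variable {F : Type} [Field F] [Fintype F] {N K : ℕ} {L : Fin K → ℕ} {p : Fin K → ℝ}

/-- The blocks of a message of length `l = b * m`. -/
def blockEquiv {l b m : ℕ} (h : l = b * m) : Fin l ≃ Fin b × Fin m :=
  (finCongr h).trans finProdFinEquiv.symm

lemma pow_mul_div_pow {M : ℕ} (k : Fin K) :
    ((M : ℝ) + 1) ^ K / ((M : ℝ) + 1) ^ (k : ℕ) = (M + 1) * (M + 1) ^ (K - 1 - k) := by
  have hM : (M : ℝ) + 1 ≠ 0 := by positivity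
  rw [div_eq_iff (pow_ne_zero _ hM), mul_assoc, ← pow_add, ← pow_succ']
  congr 1
  omega

lemma capacity_mem_of_sub_one_dvd (hN : 1 ≤ N) (hL : Antitone L) (hLpos : ∃ i, 0 < L i)
    (hp : ∀ i, 0 < p i) (hpsum : ∑ i, p i = 1) (hdvd : ∀ i, N - 1 ∣ L i) :
    expectedLength L p / ∑ j : Fin K, (L j : ℝ) / (N : ℝ) ^ (j : ℕ) ∈
      achievableRates F N L p := by
  obtain ⟨M, rfl⟩ : ∃ M, N = M + 1 := ⟨N - 1, by omega⟩
  rw [Nat.add_sub_cancel] at hdvd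
  -- For `N = 1` the divisibility would force every length to vanish.
  have hM : 0 < M := by
    obtain ⟨i, hi⟩ := hLpos
    exact Nat.pos_of_dvd_of_pos (hdvd i) hi
  choose m hm using hdvd
  have hanti : Antitone m := fun i j hij => by
    have := hL hij
    rw [hm, hm] at this
    exact Nat.le_of_mul_le_mul_left this hM
  refine ⟨blockScheme (fun i => blockEquiv (hm i)) (shiftedRequest M),
    blockScheme_isCorrect _ _ exists_shiftedRequest,
    blockScheme_isPrivate _ _ exists_perm_shiftedRequest hpsum,
    (blockScheme_rate _ _ hp hpsum (Finset.sum_nonneg fun j _ => by positivity) fun i => ?_).symm⟩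
  rw [sum_blockLength_shiftedRequest hanti]
  simp only [Fintype.card_pi, Fintype.card_fin, Finset.prod_const, Finset.card_univ]
  push_cast
  rw [Finset.mul_sum, Finset.mul_sum, Finset.mul_sum]
  refine Finset.sum_congr rfl fun k _ => ?_
  rw [mul_div_left_comm, pow_mul_div_pow, hm]
  push_cast
  ring

lemma capacity_mem_of_pow_dvd (hN : 1 ≤ N) (hL : Antitone L)
    (hp : ∀ i, 0 < p i) (hpsum : ∑ i, p i = 1) (hdvd : ∀ i, N ^ K ∣ L i) :
    expectedLength L p / ∑ j : Fin K, (L j : ℝ) / (N : ℝ) ^ (j : ℕ) ∈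
      achievableRates F N L p := by
  obtain ⟨M, rfl⟩ : ∃ M, N = M + 1 := ⟨N - 1, by omega⟩
  choose m hm using hdvd
  have hanti : Antitone m := fun i j hij => by
    have := hL hij
    rw [hm, hm] at this
    exact Nat.le_of_mul_le_mul_left this (by positivity)
  refine ⟨blockScheme (fun i => blockEquiv (hm i)) (permutedRequest M),
    blockScheme_isCorrect _ _ exists_permutedRequest,
    blockScheme_isPrivate _ _ exists_perm_permutedRequest hpsum,
    (blockScheme_rate _ _ hp hpsum (Finset.sum_nonneg fun j _ => by positivity) fun i => ?_).symm⟩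
  rw [sum_blockLength_permutedRequest hanti]
  push_cast
  rw [Finset.mul_sum]
  congr 1
  refine Finset.sum_congr rfl fun k _ => ?_
  rw [hm]
  push_cast
  rw [mul_div_right_comm, pow_mul_div_pow]
  ring

lemma capacity_mul {T : ℕ} (hT : 1 ≤ T) :
    expectedLength (fun i => T * L i) p /
        ∑ j : Fin K, ((T * L j : ℕ) : ℝ) / (N : ℝ) ^ (j : ℕ) =
      expectedLength L p / ∑ j : Fin K, (L j : ℝ) / (N : ℝ) ^ (j : ℕ) := by
  have hT0 : (T : ℝ) ≠ 0 := by exact_mod_cast (by omega : T ≠ 0)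
  simp only [expectedLength, Nat.cast_mul, mul_left_comm _ (T : ℝ), mul_div_assoc]
  rw [← Finset.mul_sum, ← Finset.mul_sum, mul_div_mul_left _ _ hT0]

end Capacity

end SemanticPIR

theorem theorem1 (F : Type) [Field F] [Fintype F] (N K : ℕ) (hN : 1 ≤ N)
    (L : Fin K → ℕ) (hL : Antitone L) (hLpos : ∃ i, 0 < L i)
    (p : Fin K → ℝ) (hp : ∀ i, 0 < p i) (hpsum : ∑ i, p i = 1) :
    (((∀ i, N ^ K ∣ L i) ∨ (∀ i, N - 1 ∣ L i)) →
      IsLUB (SemanticPIR.achievableRates F N L p)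
        (∑ i : Fin K,
          (L i : ℝ) / ((N : ℝ) ^ (i : ℕ) * SemanticPIR.expectedLength L p))⁻¹) ∧
    IsLUB (SemanticPIR.blockAchievableRates F N L p)
      (∑ i : Fin K,
        (L i : ℝ) / ((N : ℝ) ^ (i : ℕ) * SemanticPIR.expectedLength L p))⁻¹ := by
  rw [SemanticPIR.capacity_eq]
  refine ⟨fun h => IsGreatest.isLUB ⟨?_, ?_⟩, IsGreatest.isLUB ⟨?_, ?_⟩⟩
  · rcases h with h | h
    · exact SemanticPIR.capacity_mem_of_pow_dvd hN hL hp hpsum h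
    · exact SemanticPIR.capacity_mem_of_sub_one_dvd hN hL hLpos hp hpsum h
  · exact fun R hR => SemanticPIR.rate_le_capacity hN hLpos hp hpsum hR
  -- Scaling by `N ^ K` makes the symmetric scheme applicable and leaves the claimed capacity
  -- unchanged.
  · have hT : 1 ≤ N ^ K := Nat.one_le_pow _ _ hN
    refine ⟨N ^ K, hT, ?_⟩
    rw [← SemanticPIR.capacity_mul hT]
    exact SemanticPIR.capacity_mem_of_pow_dvd hN (fun i j hij => Nat.mul_le_mul_left _ (hL hij))
      hp hpsum fun i => Nat.dvd_mul_right _ _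
  · rintro R ⟨T, hT, hR⟩
    rw [← SemanticPIR.capacity_mul hT]
    obtain ⟨i, hi⟩ := hLpos
    exact SemanticPIR.rate_le_capacity hN ⟨i, Nat.mul_pos hT hi⟩ hp hpsum hR
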